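/- For sets $P,S\subseteq\mathbb{R}^2$ let $X_P,Y_P$ (resp. $X_S,Y_S$) be the sets of $x$- and $y$-coordinates of the points of $P$ (resp. $S$). We say that $S$ \emph{contains} $P$ if there are functions $f_X:X_P\to X_S$ and $f_Y:Y_P\to Y_S$ such that $\frac{f_X(x_0)-f_X(x_1)}{x_0-x_1}\ge 1$ for all $x_0>x_1$ in $X_P$, $\frac{f_Y(y_0)-f_Y(y_1)}{y_0-y_1}\ge 1$ for all $y_0>y_1$ in $Y_P$, and $(f_X(x),f_Y(y))\in S$ for all $(x,y)\in P$; otherwise $S$ is \emph{$P$-free}. For real $n>0$ let $\mathrm{px}(n,P)$ be the supremum of the Lebesgue measure $\mu_2(S)$ over all open $P$-free sets $S\subseteq[0,n]^2$. For $s,c>0$ let $P_{s,2,c}=[0,s]\times\{c,2c\}$. Theorem. For all $s>0$, $\mathrm{px}(n,P_{s,2,c})=\Theta(s^{1/2}n^{3/2})$ as $n\to\infty$, where the constants in the bounds depend only on $c$. That is, for every $c>0$ there are constants $A,B>0$ such that for every $s>0$ there is $N>0$ such that for all real $n\ge N$, $$A\,s^{1/2}n^{3/2}\le \mathrm{px}(n,P_{s,2,c})\le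 B\,s^{1/2}n^{3/2}.$$ -/

import Mathlib

open MeasureTheory
open scoped ENNReal

noncomputable section

namespace PlanarTuran

/-- The set of all `x`-coordinates of points of `P`. -/
def xCoords (P : Set (ℝ × ℝ)) : Set ℝ := Prod.fst '' P

/-- The set of all `y`-coordinates of points of `P`. -/
def yCoords (P : Set (ℝ × ℝ)) : Set ℝ := Prod.snd '' P

/-- `S` contains `P`: there are maps of the `x`-coordinates and of the `y`-coordinates of `P` to
those of `S`, all of whose difference quotients are at least `1`, that send points of `P` to
points of `S`. -/
def Contains (S P : Set (ℝ × ℝ)) : Prop :=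
  ∃ (fX : xCoords P → xCoords S) (fY : yCoords P → yCoords S),
    (∀ x₀ x₁ : xCoords P, (x₁ : ℝ) < x₀ →
      1 ≤ ((fX x₀ : ℝ) - (fX x₁ : ℝ)) / ((x₀ : ℝ) - (x₁ : ℝ))) ∧
    (∀ y₀ y₁ : yCoords P, (y₁ : ℝ) < y₀ →
      1 ≤ ((fY y₀ : ℝ) - (fY y₁ : ℝ)) / ((y₀ : ℝ) - (y₁ : ℝ))) ∧
    (∀ (p : ℝ × ℝ) (hp : p ∈ P),
      ((fX ⟨p.1, Set.mem_image_of_mem Prod.fst hp⟩ : ℝ),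
        (fY ⟨p.2, Set.mem_image_of_mem Prod.snd hp⟩ : ℝ)) ∈ S)

/-- `S` is `P`-free. -/
def IsFree (S P : Set (ℝ × ℝ)) : Prop := ¬ Contains S P

/-- The supremum of the Lebesgue measure over all open `P`-free sets `S ⊆ [0, n]²`
(as an extended nonnegative real, so that no boundedness convention enters). -/
def px (n : ℝ) (P : Set (ℝ × ℝ)) : ℝ≥0∞ :=
  sSup {m : ℝ≥0∞ | ∃ S : Set (ℝ × ℝ),
    IsOpen S ∧ S ⊆ Set.Icc 0 n ×ˢ Set.Icc 0 n ∧ IsFree S P ∧ m = volume S}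

/-- The stack of `t` horizontal segments `[0, s] × {i c}`, `i = 1, …, t`. -/
def segmentStack (s : ℝ) (t : ℕ) (c : ℝ) : Set (ℝ × ℝ) :=
  {p | p.1 ∈ Set.Icc 0 s ∧ ∃ i : ℕ, 1 ≤ i ∧ i ≤ t ∧ p.2 = (i : ℝ) * c}

end PlanarTuran

end

/-!
A set `S` contains the two-segment stack as soon as two of its horizontal slices, at heights at
least `c` apart, have an intersection of measure more than `s`: a compact subset of that
intersection has a 1-Lipschitz distribution function, and a right inverse of it is an expanding map
of `[0, s]` into the slices (`exists_expanding_map`). The problem is therefore a continuous version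
of the Kővári–Sós–Turán problem: how large can a set be if its slices at heights at least `c` apart
meet in measure at most `s`?

*Upper bound.* Let `g x` be the measure of the vertical slice of `S` at `x`. The integral of `g ^ 2`
is the measure of the set of triples `(x, y₁, y₂)` with `(x, y₁), (x, y₂) ∈ S`. Integrating over `x`
first, heights at least `c` apart contribute at most `s * n ^ 2`, and closer heights at most `2 * c`
times the measure of `S` (`lintegral_sq_volume_slice_le`). With `l = √(s * n)` and
`2 * l * g ≤ g ^ 2 + l ^ 2` this bounds the measure of `S` by `2 * l * n`, provided that `2 * c ≤ l`,
which holds for large `n` (`volume_le_of_isFree`).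

*Lower bound.* Take a prime `q` of order `√(n / s)`, divide `[0, n]` into `q ^ 2` cells indexed by
the points of the plane over `ZMod q`, and divide the height into strips of height `c`. Each strip
gets its own quadratic polynomial over `ZMod q` and carries the `q` cells on its graph. Different
graphs have at most two points in common, so rows in different strips share at most two cells, each
of length at most `s / 2`, which is too little for a copy of `[0, s]` (`isFree_graphSet`). Each row
has measure `n / q`, of order `√(s * n)`, so the measure of the set is of order `√(s * n) * n`. There
are `q ^ 3` quadratic polynomials, which for large `n` exceeds the number `n / c` of strips for every
fixed `s`; the `q ^ 2` linear polynomials would be too few for `s` large compared to `c`.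
-/

namespace PlanarTuran

/-! ### Expanding maps into sets of large measure -/

theorem measureReal_inter_Iic_mono {K : Set ℝ} (hK : IsCompact K) :
    Monotone fun t ↦ volume.real (K ∩ Set.Iic t) := fun _ _ htu ↦
  measureReal_mono (Set.inter_subset_inter_right _ (Set.Iic_subset_Iic.2 htu))
    ((measure_mono Set.inter_subset_left).trans_lt hK.measure_lt_top).ne

theorem measureReal_inter_Iic_le_add {K : Set ℝ} (hK : IsCompact K) {t u : ℝ} (htu : t ≤ u) :
    volume.real (K ∩ Set.Iic u) ≤ volume.real (K ∩ Set.Iic t) + (u - t) := by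
  rw [← Real.volume_real_Ioc_of_le htu]
  refine le_trans (measureReal_mono ?_ (measure_union_ne_top ?_ (by simp)))
    (measureReal_union_le _ _)
  · rintro z ⟨hz, hzu⟩
    rcases le_or_gt z t with h | h
    · exact Or.inl ⟨hz, h⟩
    · exact Or.inr ⟨h, hzu⟩
  · exact ((measure_mono Set.inter_subset_left).trans_lt hK.measure_lt_top).ne

/-- The distribution function `t ↦ volume (K ∩ (-∞, t])` of a compact set takes each of its positive
values at a point of `K` itself. -/
theorem exists_mem_measure_inter_Iic_eq {K : Set ℝ} (hK : IsCompact K) {v : ℝ} (hv0 : 0 < v)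
    (hv : v ≤ volume.real K) : ∃ t ∈ K, volume.real (K ∩ Set.Iic t) = v := by
  have hne : K.Nonempty := by
    rw [Set.nonempty_iff_ne_empty]
    rintro rfl
    simp at hv
    linarith
  set E : Set ℝ := {t ∈ K | v ≤ volume.real (K ∩ Set.Iic t)}
  have hcont : Continuous fun t ↦ volume.real (K ∩ Set.Iic t) := by
    refine LipschitzWith.continuous (K := 1) (LipschitzWith.of_le_add fun u t ↦ ?_)
    rcases le_total t u with h | h
    · rw [Real.dist_eq, abs_of_nonneg (sub_nonneg.2 h)]
      exact measureReal_inter_Iic_le_add hK h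
    · exact (measureReal_inter_Iic_mono hK h).trans (le_add_of_nonneg_right dist_nonneg)
  have hEc : IsCompact E := hK.inter_right (isClosed_le continuous_const hcont)
  have hEne : E.Nonempty := by
    refine ⟨sSup K, hK.sSup_mem hne, ?_⟩
    have hsub : K ⊆ Set.Iic (sSup K) := fun z hz ↦ le_csSup hK.bddAbove hz
    rwa [Set.inter_eq_left.2 hsub]
  -- the least point of `K` at which the distribution function is at least `v`
  obtain ⟨t, ⟨htK, htv⟩, hmin⟩ := hEc.exists_isLeast hEne
  refine ⟨t, htK, le_antisymm ?_ htv⟩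
  -- if the value at `t` exceeds `v`, then `K` has a point just before `t` that is already in `E`
  by_contra! hlt
  set F : Set ℝ := K ∩ Set.Iic (t - (volume.real (K ∩ Set.Iic t) - v) / 2)
  have hFv : v < volume.real F := by
    have := measureReal_inter_Iic_le_add hK
      (t := t - (volume.real (K ∩ Set.Iic t) - v) / 2) (u := t) (by linarith)
    linarith
  have hFne : F.Nonempty := by
    rw [Set.nonempty_iff_ne_empty]
    intro h
    rw [h] at hFv
    simp at hFv
    linarith
  have hFc : IsCompact F := hK.inter_right isClosed_Iic
  have hmem := hFc.sSup_mem hFne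
  have : sSup F ∈ E := by
    refine ⟨hmem.1, hFv.le.trans (measureReal_mono ?_ ?_)⟩
    · exact fun z hz ↦ ⟨hz.1, le_csSup hFc.bddAbove hz⟩
    · exact ((measure_mono Set.inter_subset_left).trans_lt hK.measure_lt_top).ne
  have h1 := hmin this
  have h2 : sSup F ≤ t - (volume.real (K ∩ Set.Iic t) - v) / 2 := hmem.2
  linarith

/-- `f` is a right inverse of the distribution function of a compact subset of `T`; the latter is
1-Lipschitz, so `f` does not decrease distances. -/
theorem exists_expanding_map {T : Set ℝ} (hT : IsOpen T) {s : ℝ} (hs : 0 ≤ s)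
    (h : ENNReal.ofReal s < volume T) :
    ∃ f : ℝ → ℝ, (∀ x ∈ Set.Icc 0 s, f x ∈ T) ∧
      ∀ x ∈ Set.Icc 0 s, ∀ x' ∈ Set.Icc 0 s, x' < x → x - x' ≤ f x - f x' := by
  obtain ⟨K, hKT, hK, hKs⟩ := hT.exists_lt_isCompact h
  have hKs' : s < volume.real K :=
    (ENNReal.ofReal_lt_iff_lt_toReal hs hK.measure_lt_top.ne).1 hKs
  -- the shift keeps the prescribed values positive, also at `x = 0`
  have key (x : ℝ) (hx : x ∈ Set.Icc 0 s) :
      ∃ t ∈ K, volume.real (K ∩ Set.Iic t) = x + (volume.real K - s) :=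
    exists_mem_measure_inter_Iic_eq hK (by linarith [hx.1]) (by linarith [hx.2])
  choose! f hfK hf using key
  refine ⟨f, fun x hx ↦ hKT (hfK x hx), fun x hx x' hx' hlt ↦ ?_⟩
  have hlt' : f x' < f x := by
    by_contra! hle
    have := measureReal_inter_Iic_mono hK hle
    simp only [hf x hx, hf x' hx'] at this
    linarith
  have := measureReal_inter_Iic_le_add hK hlt'.le
  rw [hf x hx, hf x' hx'] at this
  linarith

/-! ### The upper bound -/

theorem IsFree.volume_slice_inter_le {S : Set (ℝ × ℝ)} (hS : IsOpen S) {s c : ℝ} (hs : 0 ≤ s)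
    (hc : 0 < c) (hfree : IsFree S (segmentStack s 2 c)) {y₁ y₂ : ℝ} (hy : c ≤ y₂ - y₁) :
    volume ({x | (x, y₁) ∈ S} ∩ {x | (x, y₂) ∈ S}) ≤ ENNReal.ofReal s := by
  classical
  by_contra! hlt
  have hopen : IsOpen ({x | (x, y₁) ∈ S} ∩ {x | (x, y₂) ∈ S}) :=
    (hS.preimage (Continuous.prodMk_left y₁)).inter (hS.preimage (Continuous.prodMk_left y₂))
  obtain ⟨f, hfS, hf⟩ := exists_expanding_map hopen hs hlt
  have hx (x : xCoords (segmentStack s 2 c)) : (x : ℝ) ∈ Set.Icc 0 s := by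
    obtain ⟨x, p, hp, rfl⟩ := x
    exact hp.1
  have hyc (y : yCoords (segmentStack s 2 c)) : (y : ℝ) = c ∨ (y : ℝ) = 2 * c := by
    obtain ⟨y, p, ⟨-, i, hi1, hi2, hp⟩, rfl⟩ := y
    interval_cases i
    · left; simpa using hp
    · right; simpa using hp
  have h0 : (0 : ℝ) ∈ Set.Icc 0 s := ⟨le_rfl, hs⟩
  refine hfree ⟨fun x ↦ ⟨f x, (f x, y₁), (hfS x (hx x)).1, rfl⟩,
    fun y ↦ ⟨if (y : ℝ) = c then y₁ else y₂, ?_⟩, fun x₀ x₁ hlt ↦ ?_, fun z₀ z₁ hlt ↦ ?_, ?_⟩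
  · split_ifs
    · exact ⟨(f 0, y₁), (hfS 0 h0).1, rfl⟩
    · exact ⟨(f 0, y₂), (hfS 0 h0).2, rfl⟩
  · rw [one_le_div (by linarith)]
    exact hf _ (hx x₀) _ (hx x₁) hlt
  · rw [one_le_div (by linarith)]
    rcases hyc z₀ with h₀ | h₀ <;> rcases hyc z₁ with h₁ | h₁ <;> rw [h₀, h₁] at hlt
    · linarith
    · linarith
    · have : (2 : ℝ) * c ≠ c := by linarith
      simp only [h₀, h₁, if_true, if_neg this]
      linarith
    · linarith
  · intro p hp
    dsimp only
    split_ifs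
    · exact (hfS p.1 hp.1).1
    · exact (hfS p.1 hp.1).2

/-- The left side is the measure of the set of triples `(x, y₁, y₂)` with `(x, y₁)` and `(x, y₂)` in
`S`. For fixed heights the measure of the set of such `x` is at most `s` if `c ≤ |y₁ - y₂|`, and the pairs of closer heights contribute at most `2 * c` times that of `S`. -/
theorem lintegral_sq_volume_slice_le {S : Set (ℝ × ℝ)} (hS : IsOpen S) {s c n : ℝ} (hs : 0 ≤ s)
    (hc : 0 < c) (hfree : IsFree S (segmentStack s 2 c))
    (hn : 0 ≤ n) (hSn : S ⊆ Set.Icc 0 n ×ˢ Set.Icc 0 n) :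
    ∫⁻ x, volume (Prod.mk x ⁻¹' S) ^ 2 ≤
      ENNReal.ofReal (s * n ^ 2) + ENNReal.ofReal (2 * c) * volume S := by
  -- the triples of an abscissa and two heights, both giving points of `S`
  set W : Set (ℝ × ℝ × ℝ) := {w | (w.1, w.2.1) ∈ S ∧ (w.1, w.2.2) ∈ S}
  have hWm : MeasurableSet W :=
    (hS.preimage (by fun_prop : Continuous fun w : ℝ × ℝ × ℝ ↦ (w.1, w.2.1))).inter
      (hS.preimage (by fun_prop : Continuous fun w : ℝ × ℝ × ℝ ↦ (w.1, w.2.2))) |>.measurableSet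
  have h1 : volume W = ∫⁻ x, volume (Prod.mk x ⁻¹' S) ^ 2 := by
    rw [Measure.volume_eq_prod, Measure.prod_apply hWm]
    refine lintegral_congr fun x ↦ ?_
    rw [sq, ← Measure.prod_prod, ← Measure.volume_eq_prod]
    rfl
  have hm : Measurable fun y ↦ volume ((fun x ↦ (x, y)) ⁻¹' S) :=
    measurable_measure_prodMk_right hS.measurableSet
  set Q : Set (ℝ × ℝ) := Set.Icc 0 n ×ˢ Set.Icc 0 n
  set D : Set (ℝ × ℝ) := {z | z.2 ∈ Set.Ioo (z.1 - c) (z.1 + c)} with hD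
  have hDm : MeasurableSet D :=
    ((isOpen_lt (continuous_fst.sub continuous_const) continuous_snd).inter
      (isOpen_lt continuous_snd (continuous_fst.add continuous_const))).measurableSet
  have hpt (z : ℝ × ℝ) : volume ((fun x ↦ (x, z)) ⁻¹' W) ≤
      Q.indicator (fun _ ↦ ENNReal.ofReal s) z +
        D.indicator (fun z ↦ volume ((fun x ↦ (x, z.1)) ⁻¹' S)) z := by
    have hWz : (fun x ↦ (x, z)) ⁻¹' W = {x | (x, z.1) ∈ S} ∩ {x | (x, z.2) ∈ S} := rfl
    by_cases hzD : z ∈ D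
    · rw [Set.indicator_of_mem hzD, hWz]
      exact le_add_left (measure_mono Set.inter_subset_left)
    · by_cases hzQ : z ∈ Q
      · rw [Set.indicator_of_mem hzQ]
        refine le_add_right ?_
        have : z.2 ≤ z.1 - c ∨ z.1 + c ≤ z.2 := by
          by_contra! h
          exact hzD h
        rw [hWz]
        rcases this with h | h
        · rw [Set.inter_comm]
          exact hfree.volume_slice_inter_le hS hs hc (by linarith)
        · exact hfree.volume_slice_inter_le hS hs hc (by linarith)
      · have : (fun x ↦ (x, z)) ⁻¹' W = ∅ := by
          ext x
          simp only [hWz, Set.mem_inter_iff, Set.mem_ofPred_eq, Set.mem_empty_iff_false, iff_false]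
          exact fun h ↦ hzQ ⟨(hSn h.1).2, (hSn h.2).2⟩
        simp [this]
  have hQv : ∫⁻ z : ℝ × ℝ, Q.indicator (fun _ ↦ ENNReal.ofReal s) z =
      ENNReal.ofReal (s * n ^ 2) := by
    rw [lintegral_indicator_const (measurableSet_Icc.prod measurableSet_Icc),
      Measure.volume_eq_prod, Measure.prod_prod, Real.volume_Icc, ← ENNReal.ofReal_mul (by simpa),
      ← ENNReal.ofReal_mul hs]
    congr 1
    ring
  have hDi : Measurable (D.indicator fun z : ℝ × ℝ ↦ volume ((fun x ↦ (x, z.1)) ⁻¹' S)) :=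
    (hm.comp measurable_fst).indicator hDm
  have hDv : ∫⁻ z, D.indicator (fun z : ℝ × ℝ ↦ volume ((fun x ↦ (x, z.1)) ⁻¹' S)) z =
      ENNReal.ofReal (2 * c) * volume S := by
    rw [Measure.volume_eq_prod, lintegral_prod _ hDi.aemeasurable,
      Measure.prod_apply_symm hS.measurableSet, ← lintegral_const_mul _ hm]
    refine lintegral_congr fun y ↦ ?_
    have : (fun y' ↦ D.indicator (fun z : ℝ × ℝ ↦ volume ((fun x ↦ (x, z.1)) ⁻¹' S)) (y, y')) =
        (Set.Ioo (y - c) (y + c)).indicator fun _ ↦ volume ((fun x ↦ (x, y)) ⁻¹' S) := by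
      ext y'
      simp only [Set.indicator, hD, Set.mem_ofPred_eq]
    rw [this, lintegral_indicator_const measurableSet_Ioo, Real.volume_Ioo, mul_comm]
    congr 2
    ring
  rw [← h1, Measure.volume_eq_prod, Measure.prod_apply_symm hWm]
  refine (lintegral_mono hpt).trans ?_
  rw [lintegral_add_left (measurable_const.indicator (measurableSet_Icc.prod measurableSet_Icc)),
    hQv, hDv]

/-- The bound on the second moment of the vertical slices, turned into a bound on their first moment
by `2 * l * g ≤ g ^ 2 + l ^ 2`; the choice `l ^ 2 = s * n` balances the terms. -/
theorem volume_le_of_isFree {S : Set (ℝ × ℝ)} (hS : IsOpen S) {s c n l : ℝ} (hs : 0 ≤ s)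
    (hc : 0 < c) (hfree : IsFree S (segmentStack s 2 c)) (hn : 0 ≤ n)
    (hSn : S ⊆ Set.Icc 0 n ×ˢ Set.Icc 0 n) (hl : 2 * c ≤ l) (hl2 : l ^ 2 = s * n) :
    volume S ≤ ENNReal.ofReal (2 * l * n) := by
  have hl0 : 0 < l := by linarith
  have hfin : volume S ≠ ∞ := by
    refine ((measure_mono hSn).trans_lt ?_).ne
    exact (isCompact_Icc.prod isCompact_Icc).measure_lt_top
  have hgm : Measurable fun x ↦ volume (Prod.mk x ⁻¹' S) :=
    measurable_measure_prodMk_left hS.measurableSet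
  have hpt (x : ℝ) : ENNReal.ofReal (2 * l) * volume (Prod.mk x ⁻¹' S) ≤
      volume (Prod.mk x ⁻¹' S) ^ 2 +
        (Set.Icc 0 n).indicator (fun _ ↦ ENNReal.ofReal (l ^ 2)) x := by
    by_cases hx : x ∈ Set.Icc 0 n
    · have hfx : volume (Prod.mk x ⁻¹' S) ≠ ∞ := by
        refine ((measure_mono (t := Set.Icc 0 n) fun y hy ↦ (hSn hy).2).trans_lt ?_).ne
        exact isCompact_Icc.measure_lt_top
      rw [Set.indicator_of_mem hx, ← ENNReal.ofReal_toReal hfx,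
        ← ENNReal.ofReal_mul (by positivity), ← ENNReal.ofReal_pow (by positivity),
        ← ENNReal.ofReal_add (by positivity) (by positivity)]
      refine ENNReal.ofReal_le_ofReal ?_
      linarith [two_mul_le_add_sq l (volume (Prod.mk x ⁻¹' S)).toReal]
    · have : Prod.mk x ⁻¹' S = ∅ := by
        ext y
        simp only [Set.mem_preimage, Set.mem_empty_iff_false, iff_false]
        exact fun h ↦ hx (hSn h).1
      simp [this]
  have key : ENNReal.ofReal (2 * l) * volume S ≤
      ENNReal.ofReal (s * n ^ 2) + ENNReal.ofReal (2 * c) * volume S +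
        ENNReal.ofReal (l ^ 2 * n) := by
    calc ENNReal.ofReal (2 * l) * volume S
        = ∫⁻ x, ENNReal.ofReal (2 * l) * volume (Prod.mk x ⁻¹' S) := by
          rw [lintegral_const_mul _ hgm, Measure.volume_eq_prod,
            Measure.prod_apply hS.measurableSet]
      _ ≤ _ := lintegral_mono hpt
      _ ≤ _ := by
          rw [lintegral_add_left (hgm.pow_const 2), lintegral_indicator_const measurableSet_Icc,
            Real.volume_Icc, sub_zero, ← ENNReal.ofReal_mul (by positivity)]
          gcongr
          exact lintegral_sq_volume_slice_le hS hs hc hfree hn hSn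
  rw [← ENNReal.ofReal_toReal hfin] at key ⊢
  set a := (volume S).toReal
  have ha : 0 ≤ a := ENNReal.toReal_nonneg
  rw [← ENNReal.ofReal_mul (by positivity), ← ENNReal.ofReal_mul (by positivity),
    ← ENNReal.ofReal_add (by positivity) (by positivity),
    ← ENNReal.ofReal_add (by positivity) (by positivity),
    ENNReal.ofReal_le_ofReal_iff (by positivity)] at key
  refine ENNReal.ofReal_le_ofReal (le_of_mul_le_mul_left ?_ hl0)
  nlinarith [mul_le_mul_of_nonneg_right hl ha]

/-! ### Graphs of quadratic polynomials over a prime field -/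

/-- The value at `a` of the quadratic polynomial with coefficient vector `u`, constant term
first. -/
def quadEval {F : Type*} [Field F] (u : F × F × F) (a : F) : F :=
  u.1 + u.2.1 * a + u.2.2 * a ^ 2

/-- Two quadratic polynomials that agree at three points coincide. -/
theorem eq_of_quadEval_eq {F : Type*} [Field F] {u v : F × F × F} {a b d : F}
    (hab : a ≠ b) (had : a ≠ d) (hbd : b ≠ d) (ha : quadEval u a = quadEval v a)
    (hb : quadEval u b = quadEval v b) (hd : quadEval u d = quadEval v d) : u = v := by
  obtain ⟨u₀, u₁, u₂⟩ := u
  obtain ⟨v₀, v₁, v₂⟩ := v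
  simp only [quadEval] at ha hb hd
  -- first and second divided differences of the difference of the two polynomials
  have e1 : (u₁ - v₁) + (u₂ - v₂) * (a + b) = 0 :=
    mul_left_cancel₀ (sub_ne_zero.2 hab) (by linear_combination ha - hb)
  have e2 : (u₁ - v₁) + (u₂ - v₂) * (a + d) = 0 :=
    mul_left_cancel₀ (sub_ne_zero.2 had) (by linear_combination ha - hd)
  have e3 : u₂ = v₂ :=
    mul_left_cancel₀ (sub_ne_zero.2 hbd) (by linear_combination e1 - e2)
  subst e3
  have e4 : u₁ = v₁ := by linear_combination e1
  subst e4
  have e5 : u₀ = v₀ := by linear_combination ha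
  rw [e5]

/-- The position, in lexicographic order, of the point of the graph of the quadratic polynomial `u`
above `a`, among the `q ^ 2` points of the plane over `ZMod q`. -/
def graphIndex {q : ℕ} [Fact q.Prime] (u : ZMod q × ZMod q × ZMod q) (a : ZMod q) : ℕ :=
  a.val * q + (quadEval u a).val

theorem graphIndex_lt {q : ℕ} [Fact q.Prime] (u : ZMod q × ZMod q × ZMod q) (a : ZMod q) :
    graphIndex u a < q ^ 2 := by
  have h1 := ZMod.val_lt a
  have h2 := ZMod.val_lt (quadEval u a)
  unfold graphIndex
  nlinarith

theorem graphIndex_inj {q : ℕ} [Fact q.Prime] {u v : ZMod q × ZMod q × ZMod q} {a b : ZMod q}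
    (h : graphIndex u a = graphIndex v b) : a = b ∧ quadEval u a = quadEval v b := by
  have h1 := ZMod.val_lt (quadEval u a)
  have h2 := ZMod.val_lt (quadEval v b)
  have hq : 0 < q := (Fact.out : q.Prime).pos
  unfold graphIndex at h
  have hd := congrArg (· / q) h
  have hm := congrArg (· % q) h
  simp only [Nat.mul_comm _ q, Nat.mul_add_div hq, Nat.div_eq_of_lt h1,
    Nat.div_eq_of_lt h2, add_zero, Nat.mul_add_mod, Nat.mod_eq_of_lt h1,
    Nat.mod_eq_of_lt h2] at hd hm
  exact ⟨ZMod.val_injective q hd, ZMod.val_injective q hm⟩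

/-! ### Subdivision into cells -/

/-- The `k`-th open cell, counted from `0`, of the subdivision of `[0, ∞)` into intervals of length
`l`. The endpoints are left out so that unions of cells are open. -/
def cell (l : ℝ) (k : ℕ) : Set ℝ := Set.Ioo (k * l) ((k + 1) * l)

theorem eq_of_mem_cell {l x : ℝ} {j k : ℕ} (hj : x ∈ cell l j) (hk : x ∈ cell l k) :
    j = k := by
  have hl : 0 < l := by nlinarith [hj.1, hj.2]
  have h1 : (j : ℝ) < k + 1 := lt_of_mul_lt_mul_right (hj.1.trans hk.2) hl.le
  have h2 : (k : ℝ) < j + 1 := lt_of_mul_lt_mul_right (hk.1.trans hj.2) hl.le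
  norm_cast at h1 h2
  omega

theorem sub_lt_of_mem_cell {l x y : ℝ} {k : ℕ} (hx : x ∈ cell l k) (hy : y ∈ cell l k) :
    x - y < l := by
  nlinarith [hx.2, hy.1]

theorem disjoint_cell {l : ℝ} {j k : ℕ} (h : j ≠ k) : Disjoint (cell l j) (cell l k) :=
  Set.disjoint_left.2 fun _ hj hk ↦ h (eq_of_mem_cell hj hk)

theorem cell_subset_Icc {l n : ℝ} (hl : 0 ≤ l) {k m : ℕ} (hk : k < m) (hm : m * l ≤ n) :
    cell l k ⊆ Set.Icc 0 n := by
  have : ((k : ℝ) + 1) ≤ m := by exact_mod_cast hk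
  have h2 := mul_le_mul_of_nonneg_right this hl
  exact fun x hx ↦ ⟨(by positivity : 0 ≤ (k : ℝ) * l).trans hx.1.le, by linarith [hx.2]⟩

theorem volume_cell (l : ℝ) (k : ℕ) : volume (cell l k) = ENNReal.ofReal l := by
  rw [cell, Real.volume_Ioo]
  congr 1
  ring

/-! ### The construction for the lower bound -/

/-- The planar set whose `i`-th horizontal strip of height `c` is the product with the union of
the cells of length `l` numbered by the points of the graph of the quadratic polynomial `e i`. -/
def graphSet {q m : ℕ} [Fact q.Prime] (e : Fin m → ZMod q × ZMod q × ZMod q) (l c : ℝ) :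
    Set (ℝ × ℝ) :=
  ⋃ p : Fin m × ZMod q, cell l (graphIndex (e p.1) p.2) ×ˢ cell c p.1

section graphSet

variable {q m : ℕ} [Fact q.Prime] {e : Fin m → ZMod q × ZMod q × ZMod q} {l c : ℝ}

theorem isOpen_graphSet : IsOpen (graphSet e l c) :=
  isOpen_iUnion fun _ ↦ isOpen_Ioo.prod isOpen_Ioo

theorem graphSet_subset {n : ℝ} (hl : 0 ≤ l) (hc : 0 ≤ c) (hln : (q : ℝ) ^ 2 * l ≤ n)
    (hcn : m * c ≤ n) : graphSet e l c ⊆ Set.Icc 0 n ×ˢ Set.Icc 0 n :=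
  Set.iUnion_subset fun p ↦ Set.prod_mono
    (cell_subset_Icc hl (graphIndex_lt _ _) (by exact_mod_cast hln))
    (cell_subset_Icc hc p.1.2 hcn)

theorem volume_graphSet (hl : 0 ≤ l) :
    volume (graphSet e l c) = ENNReal.ofReal (m * q * (l * c)) := by
  rw [graphSet, measure_iUnion]
  · simp_rw [Measure.volume_eq_prod, Measure.prod_prod, volume_cell, ← ENNReal.ofReal_mul hl]
    rw [tsum_fintype, Finset.sum_const, Finset.card_univ, Fintype.card_prod, Fintype.card_fin,
      ZMod.card, nsmul_eq_mul, ← ENNReal.ofReal_natCast,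
      ← ENNReal.ofReal_mul (by positivity), Nat.cast_mul]
  · rintro ⟨i, a⟩ ⟨j, b⟩ hne
    by_cases hij : i = j
    · subst hij
      refine Set.Disjoint.set_prod_left (disjoint_cell fun h ↦ hne ?_) _ _
      exact Prod.ext rfl (graphIndex_inj h).1
    · exact Set.Disjoint.set_prod_right (disjoint_cell fun h ↦ hij (Fin.ext h)) _ _
  · exact fun p ↦ (isOpen_Ioo.prod isOpen_Ioo).measurableSet

/-- Two rows at distance at least `c` lie in different strips, so their cells have at most two cells
in common. A copy of `[0, s]` in both rows would put the images of `0`, `s / 2` and `s`, which are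
at least `s / 2` apart, into three different common cells. -/
theorem isFree_graphSet {s : ℝ} (he : Function.Injective e) (hs : 0 < s) (hc : 0 < c)
    (hl : l ≤ s / 2) : IsFree (graphSet e l c) (segmentStack s 2 c) := by
  rintro ⟨fX, fY, hX, hY, hmem⟩
  have hP₁ (x : ℝ) (hx : x ∈ Set.Icc 0 s) : (x, c) ∈ segmentStack s 2 c :=
    ⟨hx, 1, le_rfl, one_le_two, by simp⟩
  have hP₂ (x : ℝ) (hx : x ∈ Set.Icc 0 s) : (x, 2 * c) ∈ segmentStack s 2 c :=
    ⟨hx, 2, one_le_two, le_rfl, by simp⟩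
  have hx₀ : (0 : ℝ) ∈ Set.Icc 0 s := ⟨le_rfl, hs.le⟩
  have hx₁ : s / 2 ∈ Set.Icc 0 s := ⟨by positivity, by linarith⟩
  have hx₂ : s ∈ Set.Icc 0 s := ⟨hs.le, le_rfl⟩
  set z₁ : yCoords (segmentStack s 2 c) := ⟨c, _, hP₁ 0 hx₀, rfl⟩
  set z₂ : yCoords (segmentStack s 2 c) := ⟨2 * c, _, hP₂ 0 hx₀, rfl⟩
  have hz : c ≤ (fY z₂ : ℝ) - fY z₁ := by
    have := hY z₂ z₁ (by change c < 2 * c; linarith)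
    rw [one_le_div (by change 0 < 2 * c - c; linarith)] at this
    exact le_trans (by change c ≤ 2 * c - c; linarith) this
  -- every image point lies over a common point of the graphs of the two strips' polynomials
  have hcell (x : ℝ) (hx : x ∈ Set.Icc 0 s) : ∃ i j : Fin m, (fY z₁ : ℝ) ∈ cell c i ∧
      (fY z₂ : ℝ) ∈ cell c j ∧ ∃ a, quadEval (e i) a = quadEval (e j) a ∧
        (fX ⟨x, _, hP₁ x hx, rfl⟩ : ℝ) ∈ cell l (graphIndex (e i) a) := by
    obtain ⟨⟨i, a⟩, hia, hi⟩ := Set.mem_iUnion.1 (hmem _ (hP₁ x hx))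
    obtain ⟨⟨j, b⟩, hjb, hj⟩ := Set.mem_iUnion.1 (hmem _ (hP₂ x hx))
    obtain ⟨rfl, hab⟩ := graphIndex_inj (eq_of_mem_cell hia hjb)
    exact ⟨i, j, hi, hj, a, hab, hia⟩
  obtain ⟨i, j, hi, hj, a, hea, ha⟩ := hcell 0 hx₀
  obtain ⟨i', j', hi', hj', b, heb, hb⟩ := hcell (s / 2) hx₁
  obtain rfl : i = i' := Fin.ext (eq_of_mem_cell hi hi')
  obtain rfl : j = j' := Fin.ext (eq_of_mem_cell hj hj')
  obtain ⟨i', j', hi', hj', d, hed, hd⟩ := hcell s hx₂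
  obtain rfl : i = i' := Fin.ext (eq_of_mem_cell hi hi')
  obtain rfl : j = j' := Fin.ext (eq_of_mem_cell hj hj')
  have hij : i ≠ j := by
    rintro rfl
    linarith [sub_lt_of_mem_cell hj hi]
  have hsep {x x' : ℝ} (hx : x ∈ Set.Icc 0 s) (hx' : x' ∈ Set.Icc 0 s) {a b : ZMod q}
      (hlt : s / 2 ≤ x' - x)
      (ha : (fX ⟨x, _, hP₁ x hx, rfl⟩ : ℝ) ∈ cell l (graphIndex (e i) a))
      (hb : (fX ⟨x', _, hP₁ x' hx', rfl⟩ : ℝ) ∈ cell l (graphIndex (e i) b)) : a ≠ b := by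
    rintro rfl
    have h := hX ⟨x', _, hP₁ x' hx', rfl⟩ ⟨x, _, hP₁ x hx, rfl⟩ (by change x < x'; linarith)
    rw [one_le_div (by change 0 < x' - x; linarith)] at h
    have h' : x' - x ≤ _ := h
    linarith [sub_lt_of_mem_cell hb ha]
  exact hij (he (eq_of_quadEval_eq (hsep hx₀ hx₁ (by linarith) ha hb)
    (hsep hx₀ hx₂ (by linarith) ha hd) (hsep hx₁ hx₂ (by linarith) hb hd) hea heb hed))

end graphSet

/-! ### The choice of the parameters -/

theorem exists_prime_mem_Icc {r : ℝ} (hr : 1 ≤ r) :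
    ∃ q : ℕ, q.Prime ∧ (q : ℝ) ∈ Set.Icc r (4 * r) := by
  have hr0 : ⌈r⌉₊ ≠ 0 := by
    rw [Ne, Nat.ceil_eq_zero]
    linarith
  obtain ⟨q, hq, h1, h2⟩ := Nat.exists_prime_lt_and_le_two_mul ⌈r⌉₊ hr0
  have h1' : (⌈r⌉₊ : ℝ) < q := by exact_mod_cast h1
  have h2' : (q : ℝ) ≤ 2 * ⌈r⌉₊ := by exact_mod_cast h2
  exact ⟨q, hq, (Nat.le_ceil r).trans h1'.le,
    by linarith [Nat.ceil_lt_add_one (by linarith : 0 ≤ r)]⟩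

/-- The set is a `graphSet` with `⌊n / c⌋` strips and cells of length `n / q ^ 2`, where `q` is a
prime of order `√(n / s)`, so that each row has measure of order `√(s * n)`. -/
theorem exists_isFree_volume_ge {s c n : ℝ} (hs : 0 < s) (hc : 0 < c) (hn : 0 < n)
    (h1 : s / 2 ≤ n) (h2 : 2 * c ≤ n) (h3 : s ^ 3 ≤ 8 * c ^ 2 * n) :
    ∃ S : Set (ℝ × ℝ), IsOpen S ∧ S ⊆ Set.Icc 0 n ×ˢ Set.Icc 0 n ∧
      IsFree S (segmentStack s 2 c) ∧
      ENNReal.ofReal (1 / 16 * √(s * n ^ 3)) ≤ volume S := by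
  have hr2 : √(2 * n / s) ^ 2 = 2 * n / s := Real.sq_sqrt (by positivity)
  have hr1 : 1 ≤ √(2 * n / s) := by
    rw [Real.one_le_sqrt, one_le_div hs]
    linarith
  obtain ⟨q, hq, hrq, hqr⟩ := exists_prime_mem_Icc hr1
  have : Fact q.Prime := ⟨hq⟩
  have hq0 : (0 : ℝ) < q := by exact_mod_cast hq.pos
  have hq2 : 2 * n ≤ q ^ 2 * s := by
    rw [← div_le_iff₀ hs, ← hr2]
    gcongr
  have hq2' : q ^ 2 * s ≤ 32 * n := by
    rw [← le_div_iff₀ hs]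
    calc (q : ℝ) ^ 2 ≤ (4 * √(2 * n / s)) ^ 2 := by gcongr
      _ = 32 * n / s := by rw [mul_pow, hr2]; ring
  -- there are at least as many quadratic polynomials as strips
  have hqs : s ≤ q * (2 * c) := by
    refine le_of_sq_le_sq (le_of_mul_le_mul_left ?_ hs) (by positivity)
    nlinarith [mul_le_mul_of_nonneg_left hq2 (by positivity : 0 ≤ 4 * c ^ 2)]
  have hm : ⌊n / c⌋₊ ≤ q ^ 3 := by
    have : n / c ≤ (q : ℝ) ^ 3 := by
      rw [div_le_iff₀ hc]
      refine le_of_mul_le_mul_left ?_ (by positivity : 0 < 2 * s)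
      nlinarith
    exact_mod_cast (Nat.floor_le (by positivity)).trans this
  obtain ⟨e⟩ : Nonempty (Fin ⌊n / c⌋₊ ↪ ZMod q × ZMod q × ZMod q) := by
    refine Function.Embedding.nonempty_of_card_le ?_
    simpa [ZMod.card, pow_succ, mul_assoc] using hm
  have hmn : ⌊n / c⌋₊ * c ≤ n := (le_div_iff₀ hc).1 (Nat.floor_le (by positivity))
  have hmn' : n / 2 ≤ ⌊n / c⌋₊ * c := by
    have := (div_lt_iff₀ hc).1 (Nat.lt_floor_add_one (n / c))
    linarith
  refine ⟨graphSet e (n / q ^ 2) c, isOpen_graphSet,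
    graphSet_subset (by positivity) hc.le (by field_simp; rfl) hmn,
    isFree_graphSet e.injective hs hc ?_, ?_⟩
  · rw [div_le_div_iff₀ (by positivity) two_pos]
    linarith
  · rw [volume_graphSet (by positivity)]
    refine ENNReal.ofReal_le_ofReal ?_
    calc 1 / 16 * √(s * n ^ 3) ≤ n / 2 * (n / q) := by
          rw [← le_div_iff₀' (by norm_num), Real.sqrt_le_left (by positivity)]
          have : n / 2 * (n / q) / (1 / 16) = 8 * n ^ 2 / q := by field_simp; norm_num
          rw [this, div_pow, le_div_iff₀ (by positivity)]
          nlinarith [mul_le_mul_of_nonneg_left hq2' (by positivity : 0 ≤ n ^ 3),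
            (by positivity : 0 < n ^ 4)]
      _ ≤ ⌊n / c⌋₊ * c * (n / q) := by gcongr
      _ = _ := by field_simp

end PlanarTuran

theorem mainTheorem3 :
    ∀ c : ℝ, 0 < c → ∃ A B : ℝ, 0 < A ∧ 0 < B ∧
      ∀ s : ℝ, 0 < s → ∃ N : ℝ, 0 < N ∧ ∀ n : ℝ, N ≤ n →
        ENNReal.ofReal (A * s ^ (1 / 2 : ℝ) * n ^ (3 / 2 : ℝ)) ≤
            PlanarTuran.px n (PlanarTuran.segmentStack s 2 c) ∧
          PlanarTuran.px n (PlanarTuran.segmentStack s 2 c) ≤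
            ENNReal.ofReal (B * s ^ (1 / 2 : ℝ) * n ^ (3 / 2 : ℝ)) := by
  intro c hc
  refine ⟨1 / 16, 2, by norm_num, by norm_num, fun s hs ↦
    ⟨s / 2 + 2 * c + s ^ 3 / (8 * c ^ 2) + (2 * c) ^ 2 / s, by positivity, fun n hn ↦ ?_⟩⟩
  have p₁ : 0 < s ^ 3 / (8 * c ^ 2) := by positivity
  have p₂ : 0 < (2 * c) ^ 2 / s := by positivity
  have hn0 : 0 < n := by linarith
  have h₃ : s ^ 3 ≤ 8 * c ^ 2 * n := (div_le_iff₀' (by positivity)).1 (by linarith)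
  have h₄ : (2 * c) ^ 2 ≤ s * n := (div_le_iff₀' hs).1 (by linarith)
  have hn32 : n ^ (3 / 2 : ℝ) = √n * n := by
    rw [Real.sqrt_eq_rpow, ← Real.rpow_add_one hn0.ne']
    norm_num
  rw [← Real.sqrt_eq_rpow, hn32]
  constructor
  · obtain ⟨S, hS, hSn, hfree, hvol⟩ :=
      PlanarTuran.exists_isFree_volume_ge hs hc hn0 (by linarith) (by linarith) h₃
    have : √(s * n ^ 3) = √s * (√n * n) := by
      rw [pow_succ', Real.sqrt_mul hs.le, Real.sqrt_mul hn0.le, Real.sqrt_sq hn0.le]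
    rw [mul_assoc, ← this]
    exact hvol.trans (le_sSup ⟨S, hS, hSn, hfree, rfl⟩)
  · refine sSup_le ?_
    rintro _ ⟨S, hS, hSn, hfree, rfl⟩
    have hv := PlanarTuran.volume_le_of_isFree hS hs.le hc hfree hn0.le hSn
      (Real.le_sqrt_of_sq_le h₄) (Real.sq_sqrt (by positivity))
    rwa [Real.sqrt_mul hs.le, mul_assoc, mul_assoc, ← mul_assoc 2] at hv
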